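/- Let $\mathbf{R}$ be a real closed field, that is, an ordered field with the intermediate value property for polynomials: whenever $p \in \mathbf{R}[X]$ satisfies $p(a)\,p(b) < 0$ for some $a < b$ in $\mathbf{R}$, there exists $x \in \mathbf{R}$ with $a < x < b$ and $p(x) = 0$. Let $x_0 < x_1$ and $y_0 < y_1$ in $\mathbf{R}$, let $\Gamma = [x_0,x_1] \times [y_0,y_1] \subset \mathbf{R}^2$, and let $P, Q \in \mathbf{R}(X,Y)$ be rational functions. Assume that $P$ and $Q$ have no poles in $\Gamma$, that is, their denominators in lowest terms vanish nowhere on $\Gamma$, so that they define a map $f \colon \Gamma \to \mathbf{R}^2$ by $f(x,y) = (P(x,y), Q(x,y))$. If $f(\Gamma) \subset \Gamma$, then there exists $z \in \Gamma$ such that $f(z) = z$. -/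

import Mathlib

/-- A real closed field, as an ordered field with the intermediate value property for
polynomials: a polynomial that changes its sign between `a < b` has a root in `]a, b[`. -/
class IsRealClosedOrderedField (R : Type*) [Field R] [LinearOrder R] : Prop
    extends IsStrictOrderedRing R where
  exists_root_of_mul_neg : ∀ (p : Polynomial R) (a b : R), a < b →
    p.eval a * p.eval b < 0 → ∃ x ∈ Set.Ioo a b, p.eval x = 0

/-- The field `R(X, Y)` of rational functions in two variables. -/
abbrev RatFuncXY (R : Type*) [Field R] : Type _ := FractionRing (MvPolynomial (Fin 2) R)

namespace RatFuncXY

variable {R : Type*} [Field R]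

/-- The numerator of `F` in a representation in lowest terms. -/
noncomputable def num (F : RatFuncXY R) : MvPolynomial (Fin 2) R :=
  IsFractionRing.num (MvPolynomial (Fin 2) R) F

/-- The denominator of `F` in the same representation in lowest terms. -/
noncomputable def denom (F : RatFuncXY R) : MvPolynomial (Fin 2) R :=
  IsFractionRing.den (MvPolynomial (Fin 2) R) F

/-- `F` has a pole at `z` if its denominator in lowest terms vanishes at `z`. -/
def HasPoleAt (F : RatFuncXY R) (z : R × R) : Prop :=
  MvPolynomial.eval ![z.1, z.2] F.denom = 0

/-- The value of `F` at `z` (meaningful if `F` has no pole at `z`). -/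
noncomputable def eval (F : RatFuncXY R) (z : R × R) : R :=
  MvPolynomial.eval ![z.1, z.2] F.num / MvPolynomial.eval ![z.1, z.2] F.denom

theorem denom_ne_zero (F : RatFuncXY R) : F.denom ≠ 0 :=
  nonZeroDivisors.ne_zero (IsFractionRing.den (MvPolynomial (Fin 2) R) F).2

theorem isRelPrime_num_denom (F : RatFuncXY R) : IsRelPrime F.num F.denom :=
  IsFractionRing.num_den_reduced (MvPolynomial (Fin 2) R) F

theorem num_div_denom (F : RatFuncXY R) :
    algebraMap (MvPolynomial (Fin 2) R) (RatFuncXY R) F.num /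
      algebraMap (MvPolynomial (Fin 2) R) (RatFuncXY R) F.denom = F :=
  IsFractionRing.mk'_num_den' (MvPolynomial (Fin 2) R) F

theorem num_mul_eq {F : RatFuncXY R} {p q : MvPolynomial (Fin 2) R} (hq : q ≠ 0)
    (h : F = algebraMap (MvPolynomial (Fin 2) R) (RatFuncXY R) p /
      algebraMap (MvPolynomial (Fin 2) R) (RatFuncXY R) q) :
    F.num * q = p * F.denom := by
  have inj := IsFractionRing.injective (MvPolynomial (Fin 2) R) (RatFuncXY R)
  have hq' := (map_ne_zero_iff _ inj).mpr hq
  have hd' := (map_ne_zero_iff _ inj).mpr F.denom_ne_zero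
  apply inj
  rw [map_mul, map_mul]
  exact (div_eq_div_iff hd' hq').mp (F.num_div_denom.trans h)

/-- `F` has no pole at `z` iff it is a quotient of polynomials whose denominator does not
vanish at `z`. -/
theorem not_hasPoleAt_iff (F : RatFuncXY R) (z : R × R) :
    ¬ F.HasPoleAt z ↔ ∃ p q : MvPolynomial (Fin 2) R,
      MvPolynomial.eval ![z.1, z.2] q ≠ 0 ∧
      F = algebraMap (MvPolynomial (Fin 2) R) (RatFuncXY R) p /
        algebraMap (MvPolynomial (Fin 2) R) (RatFuncXY R) q := by
  refine ⟨fun h => ⟨F.num, F.denom, h, F.num_div_denom.symm⟩, ?_⟩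
  rintro ⟨p, q, hq, h⟩ h0
  have hq0 : q ≠ 0 := by rintro rfl; simp at hq
  have hdvd : F.denom ∣ q :=
    F.isRelPrime_num_denom.symm.dvd_of_dvd_mul_left
      (Dvd.intro_left p (num_mul_eq hq0 h).symm)
  obtain ⟨r, rfl⟩ := hdvd
  apply hq
  rw [map_mul, show MvPolynomial.eval ![z.1, z.2] F.denom = 0 from h0, zero_mul]

/-- The value of `F` at `z` can be computed from every representation of `F` as a quotient of
polynomials whose denominator does not vanish at `z`. -/
theorem eval_eq_div {F : RatFuncXY R} {z : R × R} {p q : MvPolynomial (Fin 2) R}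
    (hq : MvPolynomial.eval ![z.1, z.2] q ≠ 0)
    (h : F = algebraMap (MvPolynomial (Fin 2) R) (RatFuncXY R) p /
      algebraMap (MvPolynomial (Fin 2) R) (RatFuncXY R) q) :
    F.eval z = MvPolynomial.eval ![z.1, z.2] p / MvPolynomial.eval ![z.1, z.2] q := by
  have hq0 : q ≠ 0 := by rintro rfl; simp at hq
  have hd : MvPolynomial.eval ![z.1, z.2] F.denom ≠ 0 :=
    (not_hasPoleAt_iff F z).mpr ⟨p, q, hq, h⟩
  rw [eval, div_eq_div_iff hd hq, ← map_mul, ← map_mul, num_mul_eq hq0 h]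

end RatFuncXY

/-- The map `z ↦ (P(z), Q(z))` into the plane given by two rational functions. -/
noncomputable def ratMap {R : Type*} [Field R] (P Q : RatFuncXY R) (z : R × R) : R × R :=
  (P.eval z, Q.eval z)

/-!
A fixed point of `(P, Q)` is a common zero of `P - X` and `Q - Y`. After multiplication by the
squares of the denominators, which do not vanish on the rectangle, these become polynomials `u`, `v`
with `u ≥ 0` on the left side, `u ≤ 0` on the right side, `v ≥ 0` at the bottom and `v ≤ 0` at the
top, and the claim is the Poincaré–Miranda theorem `exists_common_zero`. A real closed field need
be neither complete nor archimedean, so the winding number that decides the matter is defined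
algebraically, by sign changes: `cauchyIndex f g a b` counts the sign jumps of `f / g` at the roots
of `g` in `[a, b]`, and `boundaryIndex u v a b c d` adds these up along the boundary of a rectangle.

The sign conditions on the four sides make the boundary index equal to `4`, each corner
contributing `1` (`boundaryIndex_eq_four`). On the other hand it is `0` if `u` and `v` have no
common zero in the rectangle (`boundaryIndex_eq_zero`). This has a local and a global part.

* Near each vertical segment, thin rectangles have index `0` (`exists_boundaryIndex_eq_zero`): the
  segment splits into finitely many pieces on each of which `u` or `v` has no zero, and by
  `exists_strip_ne_zero` it has none on a strip around the piece. This replaces compactness. It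
  rests on a positive lower bound for a polynomial without roots on an interval, obtained from Rolle's
  theorem, which in turn follows from the properties of the index.
* As the segment `{x} × [c, d]` moves, the index along it changes only at finitely many `x`
  (`exists_finset_cauchyIndex_vert_eq`). The index of `f / g` depends only on `f` modulo `g`, and
  the inversion formula `cauchyIndex_add_swap` exchanges `f` and `g` at the cost of signs at the
  endpoints, so the Euclidean algorithm in `Y` reduces the index to signs of finitely many
  polynomials in `x`.

Together these cover the rectangle by finitely many vertical strips of index `0`.
-/

open Polynomial Set

section OrderedField

variable {R : Type*} [Field R] [LinearOrder R]

/-! ### Signs and induction on intervals -/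

/-- The sign of a field element, as an integer. -/
def sgn (x : R) : ℤ := (SignType.sign x : ℤ)

@[simp] theorem sgn_zero : sgn (0 : R) = 0 := by simp [sgn]

theorem sgn_of_pos {x : R} (h : 0 < x) : sgn x = 1 := by simp [sgn, sign_pos h]

theorem sgn_of_neg {x : R} (h : x < 0) : sgn x = -1 := by simp [sgn, sign_neg h]

theorem sgn_nonneg_cases {x : R} (h : 0 ≤ x) : x = 0 ∧ sgn x = 0 ∨ 0 < x ∧ sgn x = 1 := by
  rcases h.eq_or_lt with rfl | h
  · simp
  · exact Or.inr ⟨h, sgn_of_pos h⟩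

theorem sgn_nonpos_cases {x : R} (h : x ≤ 0) : x = 0 ∧ sgn x = 0 ∨ x < 0 ∧ sgn x = -1 := by
  rcases h.eq_or_lt with rfl | h
  · simp
  · exact Or.inr ⟨h, sgn_of_neg h⟩

theorem sgn_mul [IsStrictOrderedRing R] (x y : R) : sgn (x * y) = sgn x * sgn y := by
  simp [sgn, sign_mul]

@[simp] theorem sgn_one [IsStrictOrderedRing R] : sgn (1 : R) = 1 := sgn_of_pos one_pos

theorem sgn_pow [IsStrictOrderedRing R] (x : R) (n : ℕ) : sgn (x ^ n) = sgn x ^ n := by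
  simp [sgn, sign_pow]

theorem sgn_mul_self [IsStrictOrderedRing R] {x : R} (h : x ≠ 0) : sgn x * sgn x = 1 := by
  rcases h.lt_or_gt with h | h
  · simp [sgn_of_neg h]
  · simp [sgn_of_pos h]

/-- An additive property of intervals that holds whenever the interval contains at most one point
of a given finite set holds for all intervals. -/
theorem interval_induction [IsStrictOrderedRing R] (Z : Finset R) (Q : R → R → Prop) {a₀ b₀ : R}
    (hab : a₀ ≤ b₀)
    (hadd : ∀ a b c, a₀ ≤ a → a ≤ b → b ≤ c → c ≤ b₀ → Q a b → Q b c → Q a c)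
    (hone : ∀ a b, a₀ ≤ a → a ≤ b → b ≤ b₀ →
      (∀ z ∈ Z, ∀ w ∈ Z, z ∈ Icc a b → w ∈ Icc a b → z = w) → Q a b) : Q a₀ b₀ := by
  suffices H : ∀ n a b, a₀ ≤ a → a ≤ b → b ≤ b₀ → (Z.filter (· ∈ Icc a b)).card = n → Q a b from
    H _ _ _ le_rfl hab le_rfl rfl
  intro n
  induction n using Nat.strong_induction_on with
  | _ n ih =>
    intro a b ha hle hb hn
    by_cases h : ∀ z ∈ Z, ∀ w ∈ Z, z ∈ Icc a b → w ∈ Icc a b → z = w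
    · exact hone a b ha hle hb h
    have : ∃ z ∈ Z, ∃ w ∈ Z, z ∈ Icc a b ∧ w ∈ Icc a b ∧ z < w := by
      push Not at h
      obtain ⟨z, hz, w, hw, hz', hw', hne⟩ := h
      rcases hne.lt_or_gt with h | h
      · exact ⟨z, hz, w, hw, hz', hw', h⟩
      · exact ⟨w, hw, z, hz, hw', hz', h⟩
    obtain ⟨z, hz, w, hw, hz', hw', hlt⟩ := this
    obtain ⟨m, hzm, hmw⟩ := exists_between hlt
    have ham : a ≤ m := hz'.1.trans hzm.le
    have hmb : m ≤ b := hmw.le.trans hw'.2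
    refine hadd a m b ha ham hmb hb (ih _ ?_ a m ha ham (hmb.trans hb) rfl)
      (ih _ ?_ m b (ha.trans ham) hmb hb rfl)
    · rw [← hn]
      refine Finset.card_lt_card (Finset.ssubset_iff_of_subset ?_ |>.2 ⟨w, ?_, ?_⟩)
      · intro t ht
        simp only [Finset.mem_filter, mem_Icc] at ht ⊢
        exact ⟨ht.1, ht.2.1, ht.2.2.trans hmb⟩
      · simp only [Finset.mem_filter]; exact ⟨hw, hw'⟩
      · simp only [Finset.mem_filter, mem_Icc, not_and, not_le]; exact fun _ _ => hmw
    · rw [← hn]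
      refine Finset.card_lt_card (Finset.ssubset_iff_of_subset ?_ |>.2 ⟨z, ?_, ?_⟩)
      · intro t ht
        simp only [Finset.mem_filter, mem_Icc] at ht ⊢
        exact ⟨ht.1, ham.trans ht.2.1, ht.2.2⟩
      · simp only [Finset.mem_filter]; exact ⟨hz, hz'⟩
      · simp only [Finset.mem_filter, mem_Icc, not_and]
        exact fun _ h => absurd h (not_le.2 hzm)

/-! ### The Cauchy index of a fraction of polynomials -/

theorem eval_eq_sub_pow_rootMultiplicity_mul {R : Type*} [Field R] (g : R[X]) (z x : R) :
    g.eval x = (x - z) ^ g.rootMultiplicity z *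
      (g /ₘ (X - C z) ^ g.rootMultiplicity z).eval x := by
  conv_lhs => rw [← pow_mul_divByMonic_rootMultiplicity_eq g z]
  simp

/-- The sign of the polynomial `g` immediately to the right of `z`: the sign at `z` of the
cofactor of the largest power of `X - z` dividing `g`. -/
noncomputable def sgnRight (g : R[X]) (z : R) : ℤ :=
  sgn ((g /ₘ (X - C z) ^ g.rootMultiplicity z).eval z)

/-- The sign of the polynomial `g` immediately to the left of `z`. -/
noncomputable def sgnLeft (g : R[X]) (z : R) : ℤ :=
  (-1) ^ g.rootMultiplicity z * sgnRight g z

/-- Twice the Cauchy index of `f / g` on `[a, b]`: each root `z` of `g` in `[a, b]` contributes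
the jump of the sign of `f / g` at `z`, where at an endpoint only the side inside `[a, b]` is taken
into account. The definition is meaningful if `f` and `g` have no common root in `[a, b]`; the index
is `0` if `g = 0`. -/
noncomputable def cauchyIndex (f g : R[X]) (a b : R) : ℤ :=
  ∑ z ∈ g.roots.toFinset, sgn (f.eval z) *
    ((if z ∈ Ico a b then sgnRight g z else 0) - (if z ∈ Ioc a b then sgnLeft g z else 0))

theorem cauchyIndex_add (f g : R[X]) {a b c : R} (hab : a ≤ b) (hbc : b ≤ c) :
    cauchyIndex f g a b + cauchyIndex f g b c = cauchyIndex f g a c := by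
  unfold cauchyIndex
  rw [← Finset.sum_add_distrib]
  refine Finset.sum_congr rfl fun z _ => ?_
  rw [← mul_add]
  congr 1
  simp only [mem_Ico, mem_Ioc]
  grind

theorem cauchyIndex_congr {f f' g : R[X]} {a b : R} (σ : ℤ)
    (h : ∀ z ∈ Icc a b, g.IsRoot z → sgn (f.eval z) = σ * sgn (f'.eval z)) :
    cauchyIndex f g a b = σ * cauchyIndex f' g a b := by
  unfold cauchyIndex
  rw [Finset.mul_sum]
  refine Finset.sum_congr rfl fun z hz => ?_
  have hz' : g.IsRoot z := isRoot_of_mem_roots (by simpa using hz)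
  by_cases hI : z ∈ Icc a b
  · rw [h z hI hz', mul_assoc]
  · have h1 : z ∉ Ico a b := fun h => hI (Ico_subset_Icc_self h)
    have h2 : z ∉ Ioc a b := fun h => hI (Ioc_subset_Icc_self h)
    simp [h1, h2]

@[simp] theorem cauchyIndex_zero_right (f : R[X]) (a b : R) : cauchyIndex f 0 a b = 0 := by
  simp [cauchyIndex]

theorem cauchyIndex_eq_zero {f g : R[X]} {a b : R} (h : ∀ z ∈ Icc a b, g.eval z ≠ 0) :
    cauchyIndex f g a b = 0 := by
  rw [cauchyIndex_congr (f' := f) 0 fun z hz hg => absurd hg (h z hz), zero_mul]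

theorem cauchyIndex_eq_zero_of_notMem_roots {f g : R[X]} {a b : R}
    (h : ∀ x ∈ Icc a b, x ∉ g.roots.toFinset) : cauchyIndex f g a b = 0 := by
  rcases eq_or_ne g 0 with rfl | hg
  · simp
  · exact cauchyIndex_eq_zero fun x hx h0 => h x hx (by simp [hg, h0])

theorem cauchyIndex_refl (f g : R[X]) (a : R) : cauchyIndex f g a a = 0 := by
  simp [cauchyIndex]

end OrderedField

section RealClosed

variable {R : Type*} [Field R] [LinearOrder R] [IsRealClosedOrderedField R]

/-! ### Telescoping of the index -/

theorem sgn_eval_eq {p : R[X]} {a b : R} (hab : a ≤ b) (h : ∀ x ∈ Icc a b, p.eval x ≠ 0) :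
    sgn (p.eval a) = sgn (p.eval b) := by
  rcases hab.eq_or_lt with rfl | hlt
  · rfl
  have ha := h a (left_mem_Icc.2 hab)
  have hb := h b (right_mem_Icc.2 hab)
  by_contra hne
  have hneg : p.eval a * p.eval b < 0 := by
    rcases ha.lt_or_gt with h1 | h1 <;> rcases hb.lt_or_gt with h2 | h2
    · exact absurd (by rw [sgn_of_neg h1, sgn_of_neg h2]) hne
    · exact mul_neg_of_neg_of_pos h1 h2
    · exact mul_neg_of_pos_of_neg h1 h2
    · exact absurd (by rw [sgn_of_pos h1, sgn_of_pos h2]) hne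
  obtain ⟨x, hx, hx0⟩ := IsRealClosedOrderedField.exists_root_of_mul_neg p a b hlt hneg
  exact h x (Ioo_subset_Icc_self hx) hx0

theorem sgnRight_eq {g : R[X]} {z b : R} (hzb : z < b)
    (h : ∀ x ∈ Ioc z b, g.eval x ≠ 0) : sgnRight g z = sgn (g.eval b) := by
  have hg : g ≠ 0 := by rintro rfl; exact h b ⟨hzb, le_rfl⟩ (by simp)
  rw [eval_eq_sub_pow_rootMultiplicity_mul g z b, sgn_mul,
    sgn_of_pos (pow_pos (sub_pos.2 hzb) _), one_mul, sgnRight]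
  refine sgn_eval_eq hzb.le fun x hx hx0 => ?_
  rcases hx.1.eq_or_lt with rfl | hlt
  · exact eval_divByMonic_pow_rootMultiplicity_ne_zero z hg hx0
  · exact h x ⟨hlt, hx.2⟩ (by rw [eval_eq_sub_pow_rootMultiplicity_mul g z x, hx0, mul_zero])

theorem sgnLeft_eq {g : R[X]} {a z : R} (haz : a < z)
    (h : ∀ x ∈ Ico a z, g.eval x ≠ 0) : sgnLeft g z = sgn (g.eval a) := by
  have hg : g ≠ 0 := by rintro rfl; exact h a ⟨le_rfl, haz⟩ (by simp)
  rw [eval_eq_sub_pow_rootMultiplicity_mul g z a, sgn_mul, sgn_pow,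
    sgn_of_neg (sub_neg.2 haz), sgnLeft, sgnRight]
  congr 1
  refine (sgn_eval_eq haz.le fun x hx hx0 => ?_).symm
  rcases hx.2.eq_or_lt with rfl | hlt
  · exact eval_divByMonic_pow_rootMultiplicity_ne_zero x hg hx0
  · exact h x ⟨hx.1, hlt⟩ (by rw [eval_eq_sub_pow_rootMultiplicity_mul g z x, hx0, mul_zero])

theorem cauchyIndex_one {g : R[X]} {a b : R} (hab : a ≤ b) :
    cauchyIndex 1 g a b = sgn (g.eval b) - sgn (g.eval a) := by
  rcases eq_or_ne g 0 with rfl | hg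
  · simp
  refine interval_induction g.roots.toFinset
    (fun a b => cauchyIndex 1 g a b = sgn (g.eval b) - sgn (g.eval a)) hab ?_ ?_
  · intro a b c _ hab hbc _ h1 h2
    rw [← cauchyIndex_add 1 g hab hbc, h1, h2]
    ring
  · intro a b _ hab _ huniq
    replace huniq : ∀ z w, g.eval z = 0 → g.eval w = 0 → z ∈ Icc a b → w ∈ Icc a b → z = w := by
      intro z w hz hw
      exact huniq z (by simp [hg, hz]) w (by simp [hg, hw])
    by_cases hroot : ∃ z ∈ Icc a b, g.eval z = 0
    · obtain ⟨z, hz, hz0⟩ := hroot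
      rw [cauchyIndex, Finset.sum_eq_single_of_mem z (by simp [hg, hz0])]
      · rw [eval_one, sgn_one, one_mul]
        congr 1
        · rcases hz.2.eq_or_lt with rfl | hlt
          · simp [hz0]
          · rw [if_pos ⟨hz.1, hlt⟩]
            refine sgnRight_eq hlt fun x hx hx0 => hx.1.ne ?_
            exact huniq z x hz0 hx0 hz ⟨hz.1.trans hx.1.le, hx.2⟩
        · rcases hz.1.eq_or_lt with rfl | hlt
          · simp [hz0]
          · rw [if_pos ⟨hlt, hz.2⟩]
            refine sgnLeft_eq hlt fun x hx hx0 => hx.2.ne ?_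
            exact huniq x z hx0 hz0 ⟨hx.1, hx.2.le.trans hz.2⟩ hz
      · intro w hw hne
        have hw0 : g.eval w = 0 := isRoot_of_mem_roots (by simpa using hw)
        have hI : w ∉ Icc a b := fun h => hne (huniq w z hw0 hz0 h hz)
        have h1 : w ∉ Ico a b := fun h => hI (Ico_subset_Icc_self h)
        have h2 : w ∉ Ioc a b := fun h => hI (Ioc_subset_Icc_self h)
        simp [h1, h2]
    · push Not at hroot
      rw [cauchyIndex_eq_zero hroot, sgn_eval_eq hab hroot, sub_self]

/-- If `f` has the same sign at all roots of `g`, the contributions to the index telescope. -/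
theorem cauchyIndex_of_sgn {f g : R[X]} {a b : R} (hab : a ≤ b) (σ : ℤ)
    (h : ∀ z ∈ Icc a b, g.eval z = 0 → sgn (f.eval z) = σ) :
    cauchyIndex f g a b = σ * (sgn (g.eval b) - sgn (g.eval a)) := by
  rw [← cauchyIndex_one hab]
  exact cauchyIndex_congr σ fun z hz hg => by simp [h z hz hg]

theorem cauchyIndex_of_ne_zero {f g : R[X]} {a b : R} (hab : a ≤ b)
    (h : ∀ z ∈ Icc a b, f.eval z ≠ 0) :
    cauchyIndex f g a b = sgn (f.eval b * g.eval b) - sgn (f.eval a * g.eval a) := by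
  rw [cauchyIndex_of_sgn hab (sgn (f.eval a)) fun z hz _ =>
      (sgn_eval_eq hz.1 fun x hx => h x ⟨hx.1, hx.2.trans hz.2⟩).symm,
    sgn_mul, sgn_mul, ← sgn_eval_eq hab h]
  ring

/-! ### Inversion of the index -/

/-- Two polynomials without a common root in `[a, b]`: an additive property of intervals holds on
`[a, b]` if it holds on all subintervals on which one of the two has no root. -/
theorem interval_induction_of_no_common_root {f g : R[X]} {a b : R} (hab : a ≤ b)
    (h : ∀ z ∈ Icc a b, f.eval z = 0 → g.eval z ≠ 0) (Q : R → R → Prop)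
    (hadd : ∀ s t r, a ≤ s → s ≤ t → t ≤ r → r ≤ b → Q s t → Q t r → Q s r)
    (hf : ∀ s t, a ≤ s → s ≤ t → t ≤ b → (∀ z ∈ Icc s t, f.eval z ≠ 0) → Q s t)
    (hg : ∀ s t, a ≤ s → s ≤ t → t ≤ b → (∀ z ∈ Icc s t, g.eval z ≠ 0) → Q s t) : Q a b := by
  rcases eq_or_ne f 0 with rfl | hf0
  · exact hg a b le_rfl hab le_rfl fun z hz => h z hz (by simp)
  rcases eq_or_ne g 0 with rfl | hg0
  · exact hf a b le_rfl hab le_rfl fun z hz h0 => h z hz h0 (by simp)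
  refine interval_induction (f * g).roots.toFinset Q hab hadd fun s t hs hst ht huniq => ?_
  by_cases hroot : ∃ z ∈ Icc s t, f.eval z = 0
  · obtain ⟨z, hz, hz0⟩ := hroot
    refine hg s t hs hst ht fun w hw hw0 => ?_
    obtain rfl : z = w := huniq z (by simp [hf0, hg0, hz0]) w (by simp [hf0, hg0, hw0]) hz hw
    exact h z ⟨hs.trans hz.1, hz.2.trans ht⟩ hz0 hw0
  · push Not at hroot
    exact hf s t hs hst ht hroot

/-- The inversion formula: by additivity it suffices to consider intervals on which `f` or `g` has
no root, and there one summand vanishes while the other one telescopes. -/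
theorem cauchyIndex_add_swap {f g : R[X]} {a b : R} (hab : a ≤ b)
    (h : ∀ z ∈ Icc a b, f.eval z = 0 → g.eval z ≠ 0) :
    cauchyIndex f g a b + cauchyIndex g f a b =
      sgn (f.eval b * g.eval b) - sgn (f.eval a * g.eval a) := by
  refine interval_induction_of_no_common_root hab h
    (fun a b => cauchyIndex f g a b + cauchyIndex g f a b =
      sgn (f.eval b * g.eval b) - sgn (f.eval a * g.eval a)) ?_ ?_ ?_
  · intro s t r _ hst htr _ h1 h2
    rw [← cauchyIndex_add f g hst htr, ← cauchyIndex_add g f hst htr]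
    linear_combination h1 + h2
  · intro s t _ hst _ hf
    rw [cauchyIndex_eq_zero hf, cauchyIndex_of_ne_zero hst hf, add_zero]
  · intro s t _ hst _ hg
    rw [cauchyIndex_eq_zero hg, cauchyIndex_of_ne_zero hst hg, zero_add,
      mul_comm (g.eval t), mul_comm (g.eval s)]

/-! ### Minima of polynomials -/

/-- Rolle's theorem, in a weak form that suffices here. If `p'` had no root in `[a, b]`, the
index of `p' / p` would be `0`, its endpoint terms cancelling, whereas each root of `p`
contributes positively. -/
theorem exists_derivative_eval_eq_zero {p : R[X]} {a b : R} (hab : a < b)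
    (ha : p.eval a = p.eval b) : ∃ x ∈ Icc a b, p.derivative.eval x = 0 := by
  by_contra! H
  set q := p - C (p.eval a) with hq
  have hd : q.derivative = p.derivative := by simp [hq]
  have hqa : q.eval a = 0 := by simp [hq]
  have hqb : q.eval b = 0 := by simp [hq, ha]
  rw [← hd] at H
  have hq0 : q ≠ 0 := by
    intro h0
    exact H a ⟨le_rfl, hab.le⟩ (by simp [h0])
  have h1 := cauchyIndex_of_ne_zero (g := q) hab.le H
  rw [hqa, hqb, mul_zero, mul_zero, sub_self] at h1
  have key : ∀ z ∈ Icc a b, q.eval z = 0 → sgn (q.derivative.eval z) * sgnRight q z = 1 ∧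
      sgn (q.derivative.eval z) * sgnLeft q z = -1 := by
    intro z hz hz0
    have hm : q.rootMultiplicity z = 1 := by
      have h2 := derivative_rootMultiplicity_of_root (p := q) (t := z) hz0
      rw [rootMultiplicity_eq_zero (H z hz)] at h2
      have := (rootMultiplicity_pos hq0).2 hz0
      omega
    have hfac := pow_mul_divByMonic_rootMultiplicity_eq q z
    rw [hm, pow_one] at hfac
    have hder : q.derivative.eval z = (q /ₘ (X - C z)).eval z := by
      conv_lhs => rw [← hfac]
      simp
    have hs : sgnRight q z = sgn (q.derivative.eval z) := by
      rw [sgnRight, hm, pow_one, hder]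
    rw [sgnLeft, hs, hm]
    have := sgn_mul_self (H z hz)
    exact ⟨this, by linear_combination -this⟩
  have hpos : 0 < cauchyIndex q.derivative q a b := by
    refine Finset.sum_pos' (fun z hz => ?_) ⟨a, by simp [hq0, hqa], ?_⟩
    · have hz0 : q.eval z = 0 := isRoot_of_mem_roots (by simpa using hz)
      rw [mul_sub, mul_ite, mul_ite, mul_zero]
      split_ifs with h2 h3 h3
      · have := key z (Ico_subset_Icc_self h2) hz0; omega
      · have := key z (Ico_subset_Icc_self h2) hz0; omega
      · have := key z (Ioc_subset_Icc_self h3) hz0; omega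
      · omega
    · have := key a ⟨le_rfl, hab.le⟩ hqa
      simp [hab, this.1]
  omega

/-- A polynomial that is positive on `[a, b]` is bounded below there by a positive constant. -/
theorem exists_pos_le_eval {p : R[X]} {a b : R} (hab : a ≤ b)
    (h : ∀ x ∈ Icc a b, 0 < p.eval x) : ∃ m, 0 < m ∧ ∀ x ∈ Icc a b, m ≤ p.eval x := by
  rcases eq_or_ne p.derivative 0 with hd | hd
  · have : CharZero R := inferInstance
    obtain ⟨c, rfl⟩ : ∃ c, p = C c := ⟨_, eq_C_of_derivative_eq_zero hd⟩
    exact ⟨c, by simpa using h a ⟨le_rfl, hab⟩, fun x _ => by simp⟩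
  -- Between critical points the minimum is attained at an endpoint.
  have main : ∀ s t, a ≤ s → s ≤ t → t ≤ b →
      (∀ z ∈ Ioo s t, p.derivative.eval z ≠ 0) →
      ∃ m, 0 < m ∧ ∀ x ∈ Icc s t, m ≤ p.eval x := by
    intro s t hs hst ht hcrit
    refine ⟨min (p.eval s) (p.eval t), lt_min (h s ⟨hs, hst.trans ht⟩) (h t ⟨hs.trans hst, ht⟩),
      fun x hx => ?_⟩
    by_contra! hlt
    obtain ⟨m, hxm, hm⟩ := exists_between hlt
    obtain ⟨hms, hmt⟩ := lt_min_iff.1 hm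
    have hsx : s < x := hx.1.lt_of_ne (by rintro rfl; exact lt_asymm hxm hms)
    have hxt : x < t := hx.2.lt_of_ne (by rintro rfl; exact lt_asymm hxm hmt)
    obtain ⟨u, hu, hu0⟩ := IsRealClosedOrderedField.exists_root_of_mul_neg (p - C m) s x hsx
      (by simpa using mul_neg_of_pos_of_neg (sub_pos.2 hms) (sub_neg.2 hxm))
    obtain ⟨v, hv, hv0⟩ := IsRealClosedOrderedField.exists_root_of_mul_neg (p - C m) x t hxt
      (by simpa using mul_neg_of_neg_of_pos (sub_neg.2 hxm) (sub_pos.2 hmt))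
    simp only [eval_sub, eval_C, sub_eq_zero] at hu0 hv0
    obtain ⟨w, hw, hw0⟩ := exists_derivative_eval_eq_zero (hu.2.trans hv.1) (hu0.trans hv0.symm)
    exact hcrit w ⟨hu.1.trans_le hw.1, hw.2.trans_lt hv.2⟩ hw0
  have hadd : ∀ s t r, a ≤ s → s ≤ t → t ≤ r → r ≤ b →
      (∃ m, 0 < m ∧ ∀ x ∈ Icc s t, m ≤ p.eval x) → (∃ m, 0 < m ∧ ∀ x ∈ Icc t r, m ≤ p.eval x) →
      ∃ m, 0 < m ∧ ∀ x ∈ Icc s r, m ≤ p.eval x := by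
    rintro s t r _ _ _ _ ⟨m, hm, h1⟩ ⟨n, hn, h2⟩
    refine ⟨min m n, lt_min hm hn, fun x hx => ?_⟩
    rcases le_total x t with hxt | hxt
    · exact (min_le_left _ _).trans (h1 x ⟨hx.1, hxt⟩)
    · exact (min_le_right _ _).trans (h2 x ⟨hxt, hx.2⟩)
  refine interval_induction p.derivative.roots.toFinset
    (fun s t => ∃ m, 0 < m ∧ ∀ x ∈ Icc s t, m ≤ p.eval x) hab hadd fun s t hs hst ht huniq => ?_
  by_cases hroot : ∃ z ∈ Icc s t, p.derivative.eval z = 0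
  · obtain ⟨z, hz, hz0⟩ := hroot
    have huz : ∀ w ∈ Icc s t, p.derivative.eval w = 0 → z = w := fun w hw hw0 =>
      huniq z (by simp [hd, hz0]) w (by simp [hd, hw0]) hz hw
    refine hadd s z t hs hz.1 hz.2 ht (main s z hs hz.1 (hz.2.trans ht) fun w hw hw0 => ?_)
      (main z t (hs.trans hz.1) hz.2 ht fun w hw hw0 => ?_)
    · exact hw.2.ne' (huz w ⟨hw.1.le, hw.2.le.trans hz.2⟩ hw0)
    · exact hw.1.ne (huz w ⟨hz.1.trans hw.1.le, hw.2.le⟩ hw0)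
  · push Not at hroot
    exact main s t hs hst ht fun z hz => hroot z (Ioo_subset_Icc_self hz)

end RealClosed

/-! ### Bivariate polynomials -/

/-- The restriction `p(x, Y)` of a bivariate polynomial `p(X, Y)` to a vertical line. -/
noncomputable def vert {R : Type*} [Field R] (p : R[X][X]) (x : R) : R[X] :=
  p.map (evalRingHom x)

/-- The restriction `p(X, y)` of a bivariate polynomial `p(X, Y)` to a horizontal line. -/
noncomputable def horiz {R : Type*} [Field R] (p : R[X][X]) (y : R) : R[X] :=
  p.eval (C y)

@[simp] theorem eval_vert {R : Type*} [Field R] (p : R[X][X]) (x y : R) :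
    (vert p x).eval y = p.evalEval x y :=
  map_evalRingHom_eval x y p

@[simp] theorem eval_horiz {R : Type*} [Field R] (p : R[X][X]) (x y : R) :
    (horiz p y).eval x = p.evalEval x y := rfl

/-- Division with remainder by a polynomial whose leading coefficient need not be invertible. -/
theorem exists_pseudo_division {A : Type*} [CommRing A] [IsDomain A] {v : A[X]} (hv : v ≠ 0)
    (u : A[X]) : ∃ (k : ℕ) (q r : A[X]),
      C v.leadingCoeff ^ k * u = q * v + r ∧ r.degree < v.degree := by
  induction u using degree_lt_wf.induction with
  | _ u ih =>
    by_cases hdeg : u.degree < v.degree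
    · exact ⟨0, 0, u, by simp, hdeg⟩
    have hdeg' := not_lt.1 hdeg
    have hu : u ≠ 0 := by
      rintro rfl
      exact hv (degree_eq_bot.1 (le_bot_iff.1 (by simpa using hdeg')))
    have hlu := leadingCoeff_ne_zero.2 hu
    have hlv := leadingCoeff_ne_zero.2 hv
    have hn : v.natDegree ≤ u.natDegree := natDegree_le_natDegree hdeg'
    set w := C u.leadingCoeff * X ^ (u.natDegree - v.natDegree) with hw
    have hwdeg : (w * v).degree = (C v.leadingCoeff * u).degree := by
      rw [degree_mul, hw, degree_C_mul_X_pow _ hlu, degree_mul, degree_C hlv, zero_add,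
        degree_eq_natDegree hv, degree_eq_natDegree hu, ← Nat.cast_add, Nat.sub_add_cancel hn]
    have hlt : (C v.leadingCoeff * u - w * v).degree < u.degree := by
      have h1 : (C v.leadingCoeff * u).degree = u.degree := by
        rw [degree_mul, degree_C hlv, zero_add]
      refine (degree_sub_lt_left hwdeg.symm (mul_ne_zero (C_ne_zero.2 hlv) hu) ?_).trans_eq h1
      rw [leadingCoeff_mul, leadingCoeff_C, leadingCoeff_mul, hw, leadingCoeff_C_mul_X_pow,
        mul_comm]
    obtain ⟨k, q, r, h, hr⟩ := ih _ hlt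
    exact ⟨k + 1, C v.leadingCoeff ^ k * w + q, r, by linear_combination h, hr⟩

section OrderedField

variable {R : Type*} [Field R] [LinearOrder R]

/-- A bivariate polynomial is Lipschitz in the first variable on bounded boxes. -/
theorem exists_abs_evalEval_sub_le [IsStrictOrderedRing R] (p : R[X][X]) (x₀ c d : R) :
    ∃ M, 0 ≤ M ∧ ∀ x, |x - x₀| ≤ 1 → ∀ y ∈ Icc c d,
      |p.evalEval x y - p.evalEval x₀ y| ≤ M * |x - x₀| := by
  -- Boundedness is carried along to make the induction go through products.
  let G : R[X][X] → Prop := fun p => ∃ B M, 0 ≤ B ∧ 0 ≤ M ∧ ∀ x, |x - x₀| ≤ 1 → ∀ y ∈ Icc c d,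
    |p.evalEval x y| ≤ B ∧ |p.evalEval x y - p.evalEval x₀ y| ≤ M * |x - x₀|
  suffices H : G p by
    obtain ⟨B, M, _, hM, h⟩ := H
    exact ⟨M, hM, fun x hx y hy => (h x hx y hy).2⟩
  have hadd : ∀ p q, G p → G q → G (p + q) := by
    rintro p q ⟨B, M, hB, hM, h⟩ ⟨B', M', hB', hM', h'⟩
    refine ⟨B + B', M + M', by positivity, by positivity, fun x hx y hy => ?_⟩
    obtain ⟨h1, h2⟩ := h x hx y hy
    obtain ⟨h3, h4⟩ := h' x hx y hy
    rw [evalEval_add, evalEval_add]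
    refine ⟨(abs_add_le _ _).trans (add_le_add h1 h3), ?_⟩
    rw [add_sub_add_comm, add_mul]
    exact (abs_add_le _ _).trans (add_le_add h2 h4)
  have hmul : ∀ p q, G p → G q → G (p * q) := by
    rintro p q ⟨B, M, hB, hM, h⟩ ⟨B', M', hB', hM', h'⟩
    refine ⟨B * B', M * B' + B * M', by positivity, by positivity, fun x hx y hy => ?_⟩
    obtain ⟨h1, h2⟩ := h x hx y hy
    obtain ⟨h3, h4⟩ := h' x hx y hy
    have h5 := (h x₀ (by simp) y hy).1
    rw [evalEval_mul, evalEval_mul, abs_mul]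
    refine ⟨mul_le_mul h1 h3 (abs_nonneg _) hB, ?_⟩
    have e : p.evalEval x y * q.evalEval x y - p.evalEval x₀ y * q.evalEval x₀ y =
        (p.evalEval x y - p.evalEval x₀ y) * q.evalEval x y +
          p.evalEval x₀ y * (q.evalEval x y - q.evalEval x₀ y) := by ring
    rw [e]
    refine (abs_add_le _ _).trans ?_
    rw [abs_mul, abs_mul]
    calc _ ≤ (M * |x - x₀|) * B' + B * (M' * |x - x₀|) := by gcongr
      _ = _ := by ring
  have hconst : ∀ r : R, G (C (C r)) := fun r =>
    ⟨|r|, 0, abs_nonneg _, le_rfl, fun x _ y _ => by simp⟩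
  have hX : G (C X) := by
    refine ⟨|x₀| + 1, 1, by positivity, zero_le_one, fun x hx y _ => ?_⟩
    simp only [evalEval_C, eval_X, one_mul, le_refl, and_true]
    calc |x| = |x₀ + (x - x₀)| := by ring_nf
      _ ≤ _ := (abs_add_le _ _).trans (by gcongr)
  have hY : G X := by
    refine ⟨max |c| |d|, 0, by positivity, le_rfl, fun x hx y hy => ?_⟩
    simp only [evalEval_X, sub_self, abs_zero, zero_mul, le_refl, and_true]
    exact abs_le_max_abs_abs hy.1 hy.2
  have hC : ∀ q : R[X], G (C q) := by
    intro q
    induction q using Polynomial.induction_on with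
    | C r => exact hconst r
    | add p q hp hq => rw [C_add]; exact hadd _ _ hp hq
    | monomial n r h =>
      rw [pow_succ, ← mul_assoc, C_mul (b := X)]
      exact hmul _ _ h hX
  induction p using Polynomial.induction_on with
  | C q => exact hC q
  | add p q hp hq => exact hadd _ _ hp hq
  | monomial n q h =>
    rw [pow_succ, ← mul_assoc]
    exact hmul _ _ h hY

/-! ### The winding number along the boundary of a rectangle -/

/-- Twice the Cauchy index of `u / v` along the boundary of the rectangle `[a, b] × [c, d]`, run
through counterclockwise; if `u` and `v` have no common zero on the boundary, this is four times the
winding number of `(u, v)` around the origin. -/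
noncomputable def boundaryIndex (u v : R[X][X]) (a b c d : R) : ℤ :=
  cauchyIndex (horiz u c) (horiz v c) a b + cauchyIndex (vert u b) (vert v b) c d -
    cauchyIndex (horiz u d) (horiz v d) a b - cauchyIndex (vert u a) (vert v a) c d

theorem boundaryIndex_add_horizontal (u v : R[X][X]) {a b e : R} (c d : R)
    (hab : a ≤ b) (hbe : b ≤ e) :
    boundaryIndex u v a b c d + boundaryIndex u v b e c d = boundaryIndex u v a e c d := by
  simp only [boundaryIndex, ← cauchyIndex_add _ _ hab hbe]
  ring

theorem boundaryIndex_add_vertical (u v : R[X][X]) (a b : R) {c d e : R}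
    (hcd : c ≤ d) (hde : d ≤ e) :
    boundaryIndex u v a b c d + boundaryIndex u v a b d e = boundaryIndex u v a b c e := by
  simp only [boundaryIndex, ← cauchyIndex_add _ _ hcd hde]
  ring

theorem boundaryIndex_eq_zero_of_right {u v : R[X][X]} {a b c d : R} (hab : a ≤ b) (hcd : c ≤ d)
    (h : ∀ x ∈ Icc a b, ∀ y ∈ Icc c d, v.evalEval x y ≠ 0) : boundaryIndex u v a b c d = 0 := by
  have hc := left_mem_Icc.2 hcd
  have hd := right_mem_Icc.2 hcd
  have ha := left_mem_Icc.2 hab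
  have hb := right_mem_Icc.2 hab
  rw [boundaryIndex, cauchyIndex_eq_zero fun x hx => by simpa using h x hx c hc,
    cauchyIndex_eq_zero fun y hy => by simpa using h b hb y hy,
    cauchyIndex_eq_zero fun x hx => by simpa using h x hx d hd,
    cauchyIndex_eq_zero fun y hy => by simpa using h a ha y hy]
  simp

end OrderedField

section RealClosed

variable {R : Type*} [Field R] [LinearOrder R] [IsRealClosedOrderedField R]

theorem sgn_eval_eq_of_notMem_roots {q : R[X]} {s t : R} (hst : s ≤ t)
    (h : ∀ x ∈ Icc s t, x ∉ q.roots.toFinset) : sgn (q.eval s) = sgn (q.eval t) := by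
  rcases eq_or_ne q 0 with rfl | hq
  · simp
  · exact sgn_eval_eq hst fun x hx h0 => h x hx (by simp [hq, h0])

/-- A polynomial without zeros on a vertical segment has no zeros on a neighbouring strip. -/
theorem exists_strip_ne_zero {p : R[X][X]} {x₀ c d : R} (hcd : c ≤ d)
    (h : ∀ y ∈ Icc c d, p.evalEval x₀ y ≠ 0) :
    ∃ δ, 0 < δ ∧ ∀ x, |x - x₀| ≤ δ → ∀ y ∈ Icc c d, p.evalEval x y ≠ 0 := by
  obtain ⟨m, hm, hle⟩ := exists_pos_le_eval (p := vert (p ^ 2) x₀) hcd fun y hy => by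
    rw [eval_vert, evalEval_pow]
    exact sq_pos_of_ne_zero (h y hy)
  obtain ⟨M, hM, hlip⟩ := exists_abs_evalEval_sub_le (p ^ 2) x₀ c d
  have hM1 : 0 < M + 1 := by positivity
  refine ⟨min 1 (m / (M + 1)), lt_min one_pos (div_pos hm hM1), fun x hx y hy h0 => ?_⟩
  have h1 := hle y hy
  have h2 := hlip x (hx.trans (min_le_left _ _)) y hy
  have h3 : |x - x₀| * (M + 1) ≤ m := (le_div_iff₀ hM1).1 (hx.trans (min_le_right _ _))
  rw [eval_vert] at h1
  rw [evalEval_pow x y p, h0, zero_pow two_ne_zero, zero_sub, abs_neg] at h2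
  have h4 := (h1.trans (le_abs_self _)).trans h2
  have h5 : |x - x₀| ≤ 0 := by linarith
  have h6 : |x - x₀| = 0 := le_antisymm h5 (abs_nonneg _)
  rw [h6, mul_zero] at h4
  exact absurd hm (not_lt.2 h4)

theorem boundaryIndex_eq_zero_of_left {u v : R[X][X]} {a b c d : R} (hab : a ≤ b) (hcd : c ≤ d)
    (h : ∀ x ∈ Icc a b, ∀ y ∈ Icc c d, u.evalEval x y ≠ 0) : boundaryIndex u v a b c d = 0 := by
  have hc := left_mem_Icc.2 hcd
  have hd := right_mem_Icc.2 hcd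
  have ha := left_mem_Icc.2 hab
  have hb := right_mem_Icc.2 hab
  rw [boundaryIndex, cauchyIndex_of_ne_zero hab fun x hx => by simpa using h x hx c hc,
    cauchyIndex_of_ne_zero hab fun x hx => by simpa using h x hx d hd,
    cauchyIndex_of_ne_zero hcd fun y hy => by simpa using h b hb y hy,
    cauchyIndex_of_ne_zero hcd fun y hy => by simpa using h a ha y hy]
  simp only [eval_vert, eval_horiz]
  ring

/-- Thin rectangles: each one is a stack of rectangles on which `u` or `v` has no zero. -/
theorem exists_boundaryIndex_eq_zero {u v : R[X][X]} {x₀ c d : R} (hcd : c ≤ d)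
    (h : ∀ y ∈ Icc c d, u.evalEval x₀ y = 0 → v.evalEval x₀ y ≠ 0) :
    ∃ δ, 0 < δ ∧ ∀ s t, x₀ - δ ≤ s → s ≤ t → t ≤ x₀ + δ → boundaryIndex u v s t c d = 0 := by
  have habs : ∀ {δ s t x : R}, x₀ - δ ≤ s → t ≤ x₀ + δ → x ∈ Icc s t → |x - x₀| ≤ δ := by
    intro δ s t x hs ht hx
    rw [abs_le]
    constructor <;> linarith [hx.1, hx.2]
  refine interval_induction_of_no_common_root (f := vert u x₀) (g := vert v x₀) hcd
    (by simpa using h) (fun c d => ∃ δ, 0 < δ ∧ ∀ s t, x₀ - δ ≤ s → s ≤ t → t ≤ x₀ + δ →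
      boundaryIndex u v s t c d = 0) ?_ ?_ ?_
  · rintro c d e _ hcd hde _ ⟨δ, hδ, h1⟩ ⟨ε, hε, h2⟩
    refine ⟨min δ ε, lt_min hδ hε, fun s t hs hst ht => ?_⟩
    have h3 := min_le_left δ ε
    have h4 := min_le_right δ ε
    rw [← boundaryIndex_add_vertical u v s t hcd hde,
      h1 s t (by linarith) hst (by linarith), h2 s t (by linarith) hst (by linarith), add_zero]
  · intro c d _ hcd _ hu
    obtain ⟨δ, hδ, h1⟩ := exists_strip_ne_zero (p := u) hcd (by simpa using hu)
    exact ⟨δ, hδ, fun s t hs hst ht => boundaryIndex_eq_zero_of_left hst hcd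
      fun x hx => h1 x (habs hs ht hx)⟩
  · intro c d _ hcd _ hv
    obtain ⟨δ, hδ, h1⟩ := exists_strip_ne_zero (p := v) hcd (by simpa using hv)
    exact ⟨δ, hδ, fun s t hs hst ht => boundaryIndex_eq_zero_of_right hst hcd
      fun x hx => h1 x (habs hs ht hx)⟩

/-! ### Vanishing of the winding number -/

/-- The index of `u / v` along the vertical segment `{x} × [c, d]` does not change with `x` outside
a finite set. The Euclidean algorithm in `Y` expresses it by the signs of finitely many polynomials
in `x`. -/
theorem exists_finset_cauchyIndex_vert_eq {c d : R} (hcd : c ≤ d) (v : R[X][X]) :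
    ∀ u : R[X][X], ∃ E : Finset R, ∀ s t, s ≤ t → (∀ x ∈ Icc s t, x ∉ E) →
      (∀ x ∈ Icc s t, ∀ y ∈ Icc c d, u.evalEval x y = 0 → v.evalEval x y ≠ 0) →
      cauchyIndex (vert u s) (vert v s) c d = cauchyIndex (vert u t) (vert v t) c d := by
  classical
  induction v using degree_lt_wf.induction with
  | _ v ih =>
    intro u
    rcases eq_or_ne v 0 with rfl | hv
    · exact ⟨∅, fun s t _ _ _ => by simp [vert]⟩
    obtain ⟨k, q, r, hdiv, hr⟩ := exists_pseudo_division hv u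
    obtain ⟨E, hE⟩ := ih r hr v
    set l := v.leadingCoeff with hl
    have hl0 : l ≠ 0 := leadingCoeff_ne_zero.2 hv
    refine ⟨E ∪ l.roots.toFinset ∪ (horiz (r * v) c).roots.toFinset ∪
      (horiz (r * v) d).roots.toFinset, fun s t hst hout hcom => ?_⟩
    simp only [Finset.mem_union, not_or] at hout
    have hev : ∀ x y, l.eval x ^ k * u.evalEval x y =
        q.evalEval x y * v.evalEval x y + r.evalEval x y := by
      intro x y
      have := congrArg (evalEval x y) hdiv
      simpa only [evalEval_mul, evalEval_pow, evalEval_add, evalEval_C] using this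
    have hlx : ∀ x ∈ Icc s t, l.eval x ≠ 0 := fun x hx h0 =>
      (hout x hx).1.1.2 (by simp [hl0, h0])
    have hcom' : ∀ x ∈ Icc s t, ∀ y ∈ Icc c d, v.evalEval x y = 0 → r.evalEval x y ≠ 0 := by
      intro x hx y hy hv0 hr0
      have h1 := hev x y
      rw [hv0, hr0, mul_zero, add_zero] at h1
      exact hcom x hx y hy ((mul_eq_zero.1 h1).resolve_left (pow_ne_zero _ (hlx x hx))) hv0
    -- One step of the Euclidean algorithm at a fixed `x`
    have step : ∀ x ∈ Icc s t, cauchyIndex (vert u x) (vert v x) c d = sgn (l.eval x) ^ k *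
        (sgn ((horiz (r * v) d).eval x) - sgn ((horiz (r * v) c).eval x) -
          cauchyIndex (vert v x) (vert r x) c d) := by
      intro x hx
      have hinv := cauchyIndex_add_swap (f := vert r x) (g := vert v x) hcd fun y hy hr0 hv0 =>
        hcom' x hx y hy (by simpa using hv0) (by simpa using hr0)
      rw [cauchyIndex_congr (f' := vert r x) (sgn (l.eval x) ^ k) fun y _ hy => ?_]
      · simp only [eval_horiz, evalEval_mul]
        simp only [eval_vert] at hinv
        rw [← hinv]
        ring
      · have h1 := hev x y
        have h2 : v.evalEval x y = 0 := by simpa using hy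
        have h3 : sgn (l.eval x) ^ k * sgn (l.eval x) ^ k = 1 := by
          rw [← mul_pow, sgn_mul_self (hlx x hx), one_pow]
        rw [h2, mul_zero, zero_add] at h1
        rw [eval_vert, eval_vert, ← h1, sgn_mul, sgn_pow, ← mul_assoc, h3, one_mul]
    rw [step s ⟨le_rfl, hst⟩, step t ⟨hst, le_rfl⟩, sgn_eval_eq hst hlx,
      sgn_eval_eq_of_notMem_roots hst fun x hx => (hout x hx).1.2,
      sgn_eval_eq_of_notMem_roots hst fun x hx => (hout x hx).2,
      hE s t hst (fun x hx => (hout x hx).1.1.1) hcom']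

/-- If `u` and `v` have no common zero in a rectangle, then the winding number of `(u, v)` along
its boundary vanishes. -/
theorem boundaryIndex_eq_zero {u v : R[X][X]} {a b c d : R} (hab : a ≤ b) (hcd : c ≤ d)
    (h : ∀ x ∈ Icc a b, ∀ y ∈ Icc c d, u.evalEval x y = 0 → v.evalEval x y ≠ 0) :
    boundaryIndex u v a b c d = 0 := by
  classical
  obtain ⟨E, hE⟩ := exists_finset_cauchyIndex_vert_eq hcd v u
  set Z := E ∪ (horiz v c).roots.toFinset ∪ (horiz v d).roots.toFinset with hZ
  -- Away from `Z` the two vertical sides cancel and the horizontal ones contribute nothing.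
  have hreg : ∀ s t, a ≤ s → s ≤ t → t ≤ b → (∀ x ∈ Icc s t, x ∉ Z) →
      boundaryIndex u v s t c d = 0 := by
    intro s t hs hst ht hout
    simp only [hZ, Finset.mem_union, not_or] at hout
    rw [boundaryIndex, hE s t hst (fun x hx => (hout x hx).1.1)
        fun x hx => h x ⟨hs.trans hx.1, hx.2.trans ht⟩,
      cauchyIndex_eq_zero_of_notMem_roots fun x hx => (hout x hx).1.2,
      cauchyIndex_eq_zero_of_notMem_roots fun x hx => (hout x hx).2]
    ring
  refine interval_induction Z (fun s t => boundaryIndex u v s t c d = 0) hab ?_ ?_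
  · intro s t r _ hst htr _ h1 h2
    rw [← boundaryIndex_add_horizontal u v c d hst htr, h1, h2, add_zero]
  · intro s t hs hst ht huniq
    by_cases hz : ∃ z ∈ Z, z ∈ Icc s t
    -- Cut off a thin rectangle around the exceptional abscissa `z`.
    · obtain ⟨z, hz, hzI⟩ := hz
      obtain ⟨δ, hδ, hloc⟩ := exists_boundaryIndex_eq_zero hcd
        (h z ⟨hs.trans hzI.1, hzI.2.trans ht⟩)
      have h1 : s ≤ max s (z - δ) := le_max_left _ _
      have h2 : max s (z - δ) ≤ z := max_le hzI.1 (by linarith)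
      have h3 : z ≤ min t (z + δ) := le_min hzI.2 (by linarith)
      have h4 : min t (z + δ) ≤ t := min_le_left _ _
      have hmid := hloc _ _ (le_max_right s (z - δ)) (h2.trans h3) (min_le_right t (z + δ))
      have hleft : boundaryIndex u v s (max s (z - δ)) c d = 0 := by
        rcases le_total s (z - δ) with hle | hle
        · rw [max_eq_right hle] at h1 h2 ⊢
          refine hreg s (z - δ) hs h1 ((h2.trans hzI.2).trans ht) fun x hx hxZ => ?_
          have := huniq x hxZ z hz ⟨hx.1, hx.2.trans (h2.trans hzI.2)⟩ hzI
          linarith [hx.2]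
        · rw [max_eq_left hle]
          simp [boundaryIndex, cauchyIndex_refl]
      have hright : boundaryIndex u v (min t (z + δ)) t c d = 0 := by
        rcases le_total t (z + δ) with hle | hle
        · rw [min_eq_left hle]
          simp [boundaryIndex, cauchyIndex_refl]
        · rw [min_eq_right hle] at h3 h4 ⊢
          refine hreg (z + δ) t ((hs.trans hzI.1).trans h3) h4 ht fun x hx hxZ => ?_
          have := huniq x hxZ z hz ⟨(hzI.1.trans h3).trans hx.1, hx.2⟩ hzI
          linarith [hx.1]
      rw [← boundaryIndex_add_horizontal u v c d (h1.trans (h2.trans h3)) h4,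
        ← boundaryIndex_add_horizontal u v c d h1 (h2.trans h3), hleft, hmid, hright]
      simp
    · push Not at hz
      exact hreg s t hs hst ht fun x hx hxZ => hz x hxZ hx

/-! ### Vector fields pointing inwards -/

/-- If `(u, v)` points weakly into the rectangle along its boundary and does not vanish there, its
index is that of a map of winding number `1`. -/
theorem boundaryIndex_eq_four {u v : R[X][X]} {a b c d : R} (hab : a ≤ b) (hcd : c ≤ d)
    (h : ∀ x ∈ Icc a b, ∀ y ∈ Icc c d, u.evalEval x y = 0 → v.evalEval x y ≠ 0)
    (hl : ∀ y ∈ Icc c d, 0 ≤ u.evalEval a y) (hr : ∀ y ∈ Icc c d, u.evalEval b y ≤ 0)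
    (hb : ∀ x ∈ Icc a b, 0 ≤ v.evalEval x c) (ht : ∀ x ∈ Icc a b, v.evalEval x d ≤ 0) :
    boundaryIndex u v a b c d = 4 := by
  have hc' := left_mem_Icc.2 hcd
  have hd' := right_mem_Icc.2 hcd
  have ha' := left_mem_Icc.2 hab
  have hb' := right_mem_Icc.2 hab
  have e1 := cauchyIndex_of_sgn (f := vert u a) (g := vert v a) hcd 1 fun y hy hv =>
    (congrArg sgn (eval_vert u _ y)).trans (sgn_of_pos 
      ((hl y hy).lt_of_ne' fun h0 => h a ha' y hy h0 (by simpa using hv)))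
  have e2 := cauchyIndex_of_sgn (f := vert u b) (g := vert v b) hcd (-1) fun y hy hv =>
    (congrArg sgn (eval_vert u _ y)).trans (sgn_of_neg 
      ((hr y hy).lt_of_ne fun h0 => h b hb' y hy h0 (by simpa using hv)))
  have e3 := cauchyIndex_of_sgn (f := horiz v c) (g := horiz u c) hab 1 fun x hx hu =>
    sgn_of_pos ((hb x hx).lt_of_ne' fun h0 => h x hx c hc' (by simpa using hu) (by simpa using h0))
  have e4 := cauchyIndex_of_sgn (f := horiz v d) (g := horiz u d) hab (-1) fun x hx hu =>
    sgn_of_neg ((ht x hx).lt_of_ne fun h0 => h x hx d hd' (by simpa using hu) (by simpa using h0))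
  have e5 := cauchyIndex_add_swap (f := horiz u c) (g := horiz v c) hab fun x hx =>
    by simpa using h x hx c hc'
  have e6 := cauchyIndex_add_swap (f := horiz u d) (g := horiz v d) hab fun x hx =>
    by simpa using h x hx d hd'
  simp only [eval_vert, eval_horiz, sgn_mul] at e1 e2 e3 e4 e5 e6
  -- Each of the four corners contributes `1`.
  have A : sgn (u.evalEval a c) + sgn (v.evalEval a c) -
      sgn (u.evalEval a c) * sgn (v.evalEval a c) = 1 := by
    rcases sgn_nonneg_cases (hl c hc') with ⟨h1, h2⟩ | ⟨h1, h2⟩ <;>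
    rcases sgn_nonneg_cases (hb a ha') with ⟨h3, h4⟩ | ⟨h3, h4⟩ <;>
    first | exact absurd h3 (h a ha' c hc' h1) | (rw [h2, h4]; norm_num)
  have B : -sgn (u.evalEval b c) + sgn (v.evalEval b c) +
      sgn (u.evalEval b c) * sgn (v.evalEval b c) = 1 := by
    rcases sgn_nonpos_cases (hr c hc') with ⟨h1, h2⟩ | ⟨h1, h2⟩ <;>
    rcases sgn_nonneg_cases (hb b hb') with ⟨h3, h4⟩ | ⟨h3, h4⟩ <;>
    first | exact absurd h3 (h b hb' c hc' h1) | (rw [h2, h4]; norm_num)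
  have C : -sgn (u.evalEval b d) - sgn (v.evalEval b d) -
      sgn (u.evalEval b d) * sgn (v.evalEval b d) = 1 := by
    rcases sgn_nonpos_cases (hr d hd') with ⟨h1, h2⟩ | ⟨h1, h2⟩ <;>
    rcases sgn_nonpos_cases (ht b hb') with ⟨h3, h4⟩ | ⟨h3, h4⟩ <;>
    first | exact absurd h3 (h b hb' d hd' h1) | (rw [h2, h4]; norm_num)
  have D : sgn (u.evalEval a d) - sgn (v.evalEval a d) +
      sgn (u.evalEval a d) * sgn (v.evalEval a d) = 1 := by
    rcases sgn_nonneg_cases (hl d hd') with ⟨h1, h2⟩ | ⟨h1, h2⟩ <;>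
    rcases sgn_nonpos_cases (ht a ha') with ⟨h3, h4⟩ | ⟨h3, h4⟩ <;>
    first | exact absurd h3 (h a ha' d hd' h1) | (rw [h2, h4]; norm_num)
  rw [boundaryIndex]
  linear_combination A + B + C + D - e1 + e2 - e3 + e4 + e5 - e6

/-- The Poincaré–Miranda theorem for two polynomials over a real closed field. -/
theorem exists_common_zero {u v : R[X][X]} {a b c d : R} (hab : a ≤ b) (hcd : c ≤ d)
    (hl : ∀ y ∈ Icc c d, 0 ≤ u.evalEval a y) (hr : ∀ y ∈ Icc c d, u.evalEval b y ≤ 0)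
    (hb : ∀ x ∈ Icc a b, 0 ≤ v.evalEval x c) (ht : ∀ x ∈ Icc a b, v.evalEval x d ≤ 0) :
    ∃ x ∈ Icc a b, ∃ y ∈ Icc c d, u.evalEval x y = 0 ∧ v.evalEval x y = 0 := by
  by_contra! H
  have h0 := boundaryIndex_eq_zero hab hcd H
  rw [boundaryIndex_eq_four hab hcd H hl hr hb ht] at h0
  norm_num at h0

end RealClosed

/-! ### Rational maps -/

/-- A polynomial in two variables as a polynomial in the second one. -/
noncomputable def toBivariate {R : Type*} [Field R] : MvPolynomial (Fin 2) R →ₐ[R] R[X][X] :=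
  MvPolynomial.aeval ![C X, X]

theorem evalEval_toBivariate {R : Type*} [Field R] (p : MvPolynomial (Fin 2) R) (x y : R) :
    (toBivariate p).evalEval x y = MvPolynomial.eval ![x, y] p := by
  induction p using MvPolynomial.induction_on with
  | C r => simp [toBivariate]
  | add p q hp hq => simp [hp, hq]
  | mul_X p i hp =>
    rw [map_mul, map_mul, evalEval_mul, hp]
    fin_cases i <;> simp [toBivariate, evalEval_C]

/-- The polynomial `(num F - ℓ · denom F) · denom F`, which off the poles of `F` has the sign and
the zeros of `F - ℓ`. -/
noncomputable def displacement {R : Type*} [Field R] (F : RatFuncXY R) (ℓ : R[X][X]) : R[X][X] :=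
  (toBivariate F.num - ℓ * toBivariate F.denom) * toBivariate F.denom

theorem evalEval_displacement {R : Type*} [Field R] {F : RatFuncXY R} {x y : R}
    (h : ¬ F.HasPoleAt (x, y)) (ℓ : R[X][X]) :
    (displacement F ℓ).evalEval x y =
      (F.eval (x, y) - ℓ.evalEval x y) * MvPolynomial.eval ![x, y] F.denom ^ 2 := by
  have h' : MvPolynomial.eval ![x, y] F.denom ≠ 0 := h
  rw [displacement, evalEval_mul, evalEval_sub, evalEval_mul, evalEval_toBivariate,
    evalEval_toBivariate, RatFuncXY.eval]
  field_simp

theorem mainTheorem10 {R : Type*} [Field R] [LinearOrder R] [IsRealClosedOrderedField R]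
    (P Q : RatFuncXY R) (x₀ x₁ y₀ y₁ : R) (hx : x₀ < x₁) (hy : y₀ < y₁)
    (hP : ∀ z ∈ Set.Icc x₀ x₁ ×ˢ Set.Icc y₀ y₁, ¬ P.HasPoleAt z)
    (hQ : ∀ z ∈ Set.Icc x₀ x₁ ×ˢ Set.Icc y₀ y₁, ¬ Q.HasPoleAt z)
    (hf : Set.MapsTo (ratMap P Q) (Set.Icc x₀ x₁ ×ˢ Set.Icc y₀ y₁)
      (Set.Icc x₀ x₁ ×ˢ Set.Icc y₀ y₁)) :
    ∃ z ∈ Set.Icc x₀ x₁ ×ˢ Set.Icc y₀ y₁, ratMap P Q z = z := by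
  have hu : ∀ x ∈ Icc x₀ x₁, ∀ y ∈ Icc y₀ y₁, (displacement P (C X)).evalEval x y =
      (P.eval (x, y) - x) * MvPolynomial.eval ![x, y] P.denom ^ 2 := fun x hx y hy => by
    rw [evalEval_displacement (hP (x, y) ⟨hx, hy⟩), evalEval_C, eval_X]
  have hv : ∀ x ∈ Icc x₀ x₁, ∀ y ∈ Icc y₀ y₁, (displacement Q X).evalEval x y =
      (Q.eval (x, y) - y) * MvPolynomial.eval ![x, y] Q.denom ^ 2 := fun x hx y hy => by
    rw [evalEval_displacement (hQ (x, y) ⟨hx, hy⟩), evalEval_X]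
  have hPI : ∀ x ∈ Icc x₀ x₁, ∀ y ∈ Icc y₀ y₁, P.eval (x, y) ∈ Icc x₀ x₁ := fun x hx y hy =>
    (hf (x := (x, y)) ⟨hx, hy⟩).1
  have hQI : ∀ x ∈ Icc x₀ x₁, ∀ y ∈ Icc y₀ y₁, Q.eval (x, y) ∈ Icc y₀ y₁ := fun x hx y hy =>
    (hf (x := (x, y)) ⟨hx, hy⟩).2
  have hx₀ := left_mem_Icc.2 hx.le
  have hx₁ := right_mem_Icc.2 hx.le
  have hy₀ := left_mem_Icc.2 hy.le
  have hy₁ := right_mem_Icc.2 hy.le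
  obtain ⟨x, hxI, y, hyI, hux, hvy⟩ := exists_common_zero (u := displacement P (C X))
    (v := displacement Q X) hx.le hy.le
    (fun y hyI => by
      rw [hu _ hx₀ _ hyI]
      exact mul_nonneg (sub_nonneg.2 (hPI _ hx₀ _ hyI).1) (sq_nonneg _))
    (fun y hyI => by
      rw [hu _ hx₁ _ hyI]
      exact mul_nonpos_of_nonpos_of_nonneg (sub_nonpos.2 (hPI _ hx₁ _ hyI).2) (sq_nonneg _))
    (fun x hxI => by
      rw [hv _ hxI _ hy₀]
      exact mul_nonneg (sub_nonneg.2 (hQI _ hxI _ hy₀).1) (sq_nonneg _))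
    (fun x hxI => by
      rw [hv _ hxI _ hy₁]
      exact mul_nonpos_of_nonpos_of_nonneg (sub_nonpos.2 (hQI _ hxI _ hy₁).2) (sq_nonneg _))
  rw [hu x hxI y hyI] at hux
  rw [hv x hxI y hyI] at hvy
  refine ⟨(x, y), ⟨hxI, hyI⟩, Prod.ext ?_ ?_⟩
  · exact sub_eq_zero.1 ((mul_eq_zero.1 hux).resolve_right (pow_ne_zero 2 (hP (x, y) ⟨hxI, hyI⟩)))
  · exact sub_eq_zero.1 ((mul_eq_zero.1 hvy).resolve_right (pow_ne_zero 2 (hQ (x, y) ⟨hxI, hyI⟩)))
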